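/- A Rickart $^*$-algebra is a complex $^*$-algebra $T$ (with unit $\mathbf 1$) in which, for every $x$, the right annihilator $r(x)=\{t\in T: xt=0\}$ equals $eT$ for some projection $e=e^*=e^2$. Let $T_h=\{x\in T: x^*=x\}$, let $K$ be the set of all finite sums $\sum_i x_i^*x_i$ with $x_i\in T$, and for $x,y\in T_h$ write $x\le y$ if $y-x\in K$. $T$ is called an $RO^*$-algebra if it is a Rickart $^*$-algebra satisfying: (PSR) every $x\in K$ has some $y\in K\cap\{x\}''$ with $y^2=x$, where $\{x\}''$ is the bicommutant of $x$; (FR) if $x_n\in T_h$ and $\varepsilon_n\in\mathbb R$ satisfy $0\le x_n\le\varepsilon_n\mathbf 1$ for all $n$ and $\sum_n\varepsilon_n<\infty$, then $\sup_n\sum_{k=1}^n x_k$ exists in $T_h$. Theorem. Let $T$ be a commutative $RO^*$-algebra. Then $(T_h,\le)$ is a (real) vector lattice. More precisely, for $x\in T_h$ there is $y\in K$ with $y^2=x^2$, and for every such $y$ there is a projection $e$ with $r(y-x)=eT$; for every such $y$ and $e$, $$x\vee 0=ye .$$ Moreover, $T_h$ is conditionally $\sigma$-complete: every nonempty countable subset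 of $T_h$ that is bounded above (respectively, below) has a supremum (respectively, an infimum) in $T_h$. -/

import Mathlib

section ROStar

/-- The cone `K` of all finite sums `∑ xᵢ⋆ xᵢ` in a star ring. -/
def posCone (T : Type*) [Ring T] [StarRing T] : Set T :=
  {x | ∃ (n : ℕ) (u : Fin n → T), x = ∑ i, star (u i) * u i}

theorem zero_mem_posCone (T : Type*) [Ring T] [StarRing T] : (0 : T) ∈ posCone T :=
  ⟨0, fun _ => 0, by simp⟩

theorem add_mem_posCone {T : Type*} [Ring T] [StarRing T] {x y : T}
    (hx : x ∈ posCone T) (hy : y ∈ posCone T) : x + y ∈ posCone T := by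
  obtain ⟨n, u, rfl⟩ := hx
  obtain ⟨m, v, rfl⟩ := hy
  exact ⟨n + m, Fin.append u v, by simp [Fin.sum_univ_add]⟩

/-- The relation `x ≤ y ↔ y - x ∈ K` on the self-adjoint part `T_h`. It is a preorder for every
star ring (antisymmetry needs more). -/
@[reducible] def hermitianPreorder (T : Type*) [Ring T] [StarRing T] :
    Preorder (selfAdjoint T) where
  le x y := (y : T) - (x : T) ∈ posCone T
  le_refl x := by
    rw [sub_self]
    exact zero_mem_posCone T
  le_trans x y z hxy hyz := by
    rw [← sub_add_sub_cancel (z : T) (y : T) (x : T)]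
    exact add_mem_posCone hyz hxy

/-- The right annihilator of an element. -/
def rightAnnihilator {T : Type*} [Ring T] (x : T) : Set T := {t | x * t = 0}

/-- `e` is a projection (a self-adjoint idempotent) that generates the right annihilator of `x` as
a principal right ideal: `r(x) = e T`. In other words `1 - e` is the right projection of `x`. -/
def IsAnnihilatingProjection {T : Type*} [Ring T] [StarRing T] (x e : T) : Prop :=
  IsStarProjection e ∧ rightAnnihilator x = {t | ∃ s : T, t = e * s}

/-- A Rickart star ring: the right annihilator of each element is the principal right ideal
generated by a projection. -/
def IsRickartStarRing (T : Type*) [Ring T] [StarRing T] : Prop :=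
  ∀ x : T, ∃ e : T, IsAnnihilatingProjection x e

/-- The positive square root axiom (PSR): each `x ∈ K` has a square root in `K ∩ {x}''`. -/
def PositiveSquareRootAxiom (T : Type*) [Ring T] [StarRing T] : Prop :=
  ∀ x ∈ posCone T, ∃ y ∈ posCone T ∩ Set.centralizer (Set.centralizer {x}), y ^ 2 = x

/-- The Fisher-Riesz axiom (FR): if `0 ≤ xₙ ≤ εₙ 1` in `T_h` and `∑ εₙ < ∞`, then the partial sums
of `∑ xₙ` have a supremum in `T_h`. -/
def FisherRieszAxiom (T : Type*) [Ring T] [StarRing T] [Algebra ℂ T] [StarModule ℂ T] : Prop :=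
  letI : Preorder (selfAdjoint T) := hermitianPreorder T
  ∀ (x : ℕ → selfAdjoint T) (ε : ℕ → ℝ),
    (∀ n, 0 ≤ x n ∧ x n ≤ ε n • (1 : selfAdjoint T)) → Summable ε →
      ∃ s : selfAdjoint T, IsLUB (Set.range fun n : ℕ => ∑ k ∈ Finset.range (n + 1), x k) s

/-- A Rickart ordered star algebra over `ℂ`. -/
structure IsROStarAlgebra (T : Type*) [Ring T] [StarRing T] [Algebra ℂ T] [StarModule ℂ T] :
    Prop where
  rickart : IsRickartStarRing T
  psr : PositiveSquareRootAxiom T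
  fr : FisherRieszAxiom T

/-- Conditional σ-completeness: nonempty countable sets that are bounded above (below) have a
supremum (infimum). -/
def IsConditionallySigmaComplete (α : Type*) [Preorder α] : Prop :=
  ∀ S : Set α, S.Countable → S.Nonempty →
    (BddAbove S → ∃ s, IsLUB S s) ∧ (BddBelow S → ∃ s, IsGLB S s)

end ROStar

/-! On a commutative `T_h`, idempotents act as regions. If y² = x² with y ≥ 0, then (y - x)(y + x) =
0, so the projection e with r(y - x) = eT marks where y = x, and y = -x on 1 - e. Hence ye is the
positive part of x (`isLUB_mul_projection`); translation gives all binary suprema. For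
σ-completeness, FR supplies suprema of sequences of idempotents (`exists_idempotent_sup`). A
sequence in [0, 1] then gets its supremum as a binary expansion whose digits are idempotents, summed
by FR again (`exists_isLUB_of_mem_unit_interval`). Multiplying by a positive unit reduces an
arbitrary bound to 1. -/

section OrderedRing

/-! ### Countable suprema in an ordered commutative ring -/

variable {A : Type*} [CommRing A] [PartialOrder A]

/-- Every annihilator is generated by an idempotent. -/
def HasAnnihilatorIdempotents (A : Type*) [CommRing A] : Prop :=
  ∀ x : A, ∃ e : A, e * e = e ∧ x * e = 0 ∧ ∀ t, x * t = 0 → e * t = t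

/-- Every element is nonnegative on some idempotent and nonpositive on its complement. -/
def HasSignIdempotents (A : Type*) [CommRing A] [PartialOrder A] : Prop :=
  ∀ w : A, ∃ p : A, p * p = p ∧ 0 ≤ w * p ∧ w * (1 - p) ≤ 0

/-- The Fisher-Riesz axiom for an ordered ring that is a real vector space. -/
def HasFisherRiesz (A : Type*) [CommRing A] [PartialOrder A] [Module ℝ A] : Prop :=
  ∀ (x : ℕ → A) (ε : ℕ → ℝ), (∀ n, 0 ≤ x n ∧ x n ≤ ε n • (1 : A)) → Summable ε →
    ∃ s, IsLUB (Set.range fun n : ℕ => ∑ k ∈ Finset.range (n + 1), x k) s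

theorem idempotent_nonneg (hsq : ∀ x : A, 0 ≤ x * x) {p : A} (hp : p * p = p) : 0 ≤ p :=
  hp ▸ hsq p

theorem one_sub_idempotent {A : Type*} [CommRing A] {p : A} (hp : p * p = p) : (1 - p) * (1 - p) = 1 - p := by
  linear_combination hp

theorem one_sub_idempotent_nonneg (hsq : ∀ x : A, 0 ≤ x * x) {p : A} (hp : p * p = p) :
    0 ≤ 1 - p :=
  idempotent_nonneg hsq (one_sub_idempotent hp)

variable [IsOrderedRing A] [Module ℝ A] [IsScalarTower ℝ A A] [IsOrderedModule ℝ A]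

/-- FR sums 2⁻ⁿ eₙ to some s, and p is the support of s, the complement of its annihilator f. If x
kills every eₙ and g generates the annihilator of x, then sg still bounds the partial sums, so s
lives on g and x kills p. -/
theorem exists_idempotent_sup (hsq : ∀ x : A, 0 ≤ x * x) (hann : HasAnnihilatorIdempotents A)
    (hfr : HasFisherRiesz A) (e : ℕ → A) (he : ∀ n, e n * e n = e n) :
    ∃ p : A, p * p = p ∧ (∀ n, e n * p = e n) ∧ ∀ x, (∀ n, x * e n = 0) → x * p = 0 := by
  have he0 n : 0 ≤ e n := idempotent_nonneg hsq (he n)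
  have hx0 n : 0 ≤ ((1 / 2 : ℝ) ^ n) • e n := smul_nonneg (by positivity) (he0 n)
  obtain ⟨s, hs⟩ := hfr (fun n => ((1 / 2 : ℝ) ^ n) • e n) (fun n => (1 / 2 : ℝ) ^ n)
    (fun n => ⟨hx0 n, smul_le_smul_of_nonneg_left
      (sub_nonneg.1 (one_sub_idempotent_nonneg hsq (he n))) (by positivity)⟩)
    summable_geometric_two
  have hle n : ((1 / 2 : ℝ) ^ n) • e n ≤ s :=
    (Finset.single_le_sum (f := fun n => ((1 / 2 : ℝ) ^ n) • e n) (fun i _ => hx0 i)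
      (Finset.self_mem_range_succ n)).trans (hs.1 ⟨n, rfl⟩)
  have hs0 : 0 ≤ s := (hx0 0).trans (hle 0)
  obtain ⟨f, hf, hsf, hft⟩ := hann s
  have hf0 := idempotent_nonneg hsq hf
  refine ⟨1 - f, one_sub_idempotent hf, fun n => ?_, fun x hx => ?_⟩
  · have h1 := mul_le_mul_of_nonneg_right (hle n) hf0
    rw [hsf, smul_mul_assoc] at h1
    have h2 : ((1 / 2 : ℝ) ^ n) • (e n * f) = 0 :=
      le_antisymm h1 (smul_nonneg (by positivity) (mul_nonneg (he0 n) hf0))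
    have h3 : e n * f = 0 := (smul_eq_zero.1 h2).resolve_left (by positivity)
    linear_combination -h3
  · obtain ⟨g, hg, hxg, hgt⟩ := hann x
    have hg0 := idempotent_nonneg hsq hg
    have h1 : s ≤ s * g := hs.2 <| by
      rintro _ ⟨n, rfl⟩
      have h2 := mul_le_mul_of_nonneg_right (hs.1 ⟨n, rfl⟩) hg0
      refine le_trans (le_of_eq ?_) h2
      simp only [Finset.sum_mul, smul_mul_assoc]
      exact Finset.sum_congr rfl fun k _ => by rw [mul_comm (e k), hgt _ (hx k)]
    have h2 : s * (1 - g) = 0 :=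
      le_antisymm (by rw [mul_sub, mul_one]; exact sub_nonpos.2 h1)
        (mul_nonneg hs0 (one_sub_idempotent_nonneg hsq hg))
    linear_combination (-x) * hft _ h2 + (1 - f) * hxg

/-- An idempotent on which all upper bounds of a sequence are nonnegative, and off which the
sequence is nonpositive. -/
theorem exists_idempotent_of_seq (hsq : ∀ x : A, 0 ≤ x * x) (hann : HasAnnihilatorIdempotents A)
    (hsign : HasSignIdempotents A) (hfr : HasFisherRiesz A) (w : ℕ → A) :
    ∃ p : A, p * p = p ∧ (∀ n, w n * (1 - p) ≤ 0) ∧ ∀ v, (∀ n, w n ≤ v) → 0 ≤ v * p := by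
  choose e he hpos hneg using fun n => hsign (w n)
  obtain ⟨p, hp, hep, hsup⟩ := exists_idempotent_sup hsq hann hfr e he
  refine ⟨p, hp, fun n => ?_, fun v hv => ?_⟩
  · have h := mul_nonpos_of_nonpos_of_nonneg (hneg n) (one_sub_idempotent_nonneg hsq hp)
    refine le_trans (le_of_eq ?_) h
    linear_combination -w n * hep n
  · obtain ⟨q, hq, hvq, hvq'⟩ := hsign v
    -- On eₙ(1 - q), v is nonpositive yet dominates the nonnegative wₙ, so v(1 - q) kills every eₙ.
    have h : v * (1 - q) * p = 0 := hsup _ fun n => by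
      have h0 := idempotent_nonneg hsq (he n)
      refine le_antisymm (mul_nonpos_of_nonpos_of_nonneg hvq' h0) ?_
      rw [mul_right_comm]
      exact mul_nonneg ((hpos n).trans (mul_le_mul_of_nonneg_right (hv n) h0))
        (one_sub_idempotent_nonneg hsq hq)
    have h' : v * p = v * q * p := by linear_combination h
    rw [h']
    exact mul_nonneg hvq (idempotent_nonneg hsq hp)

/-- Archimedean property: FR applied to the constant sequence wq gives a supremum s of its
multiples, and shifting the index by one yields s ≤ s - wq. -/
theorem nonpos_of_forall_le_half_pow (hsign : HasSignIdempotents A) (hsq : ∀ x : A, 0 ≤ x * x)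
    (hfr : HasFisherRiesz A) {w : A} (hw : ∀ k : ℕ, w ≤ ((1 / 2 : ℝ) ^ k) • (1 : A)) :
    w ≤ 0 := by
  obtain ⟨q, hq, hwq, hwq'⟩ := hsign w
  have hq0 := idempotent_nonneg hsq hq
  have hq1 := one_sub_idempotent_nonneg hsq hq
  obtain ⟨s, hs⟩ := hfr (fun _ => w * q) (fun n => (1 / 2 : ℝ) ^ n) (fun n => ⟨hwq, by
    refine (mul_le_mul_of_nonneg_right (hw n) hq0).trans ?_
    rw [smul_mul_assoc, one_mul]
    exact smul_le_smul_of_nonneg_left (sub_nonneg.1 hq1) (by positivity)⟩) summable_geometric_two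
  have h : s ≤ s - w * q := hs.2 <| by
    rintro _ ⟨n, rfl⟩
    have := hs.1 ⟨n + 1, rfl⟩
    simp only [Finset.sum_range_succ _ (n + 1)] at this
    exact le_sub_iff_add_le.2 this
  have h' : w * q ≤ 0 := by simpa using h
  have := add_nonpos h' hwq'
  refine le_trans (le_of_eq ?_) this
  ring

theorem exists_isLUB_of_mem_unit_interval (hsq : ∀ x : A, 0 ≤ x * x)
    (hann : HasAnnihilatorIdempotents A) (hsign : HasSignIdempotents A) (hfr : HasFisherRiesz A)
    (x : ℕ → A) (hx0 : ∀ n, 0 ≤ x n) (hx1 : ∀ n, x n ≤ 1) : ∃ s, IsLUB (Set.range x) s := by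
  choose P hP hPneg hPpos using exists_idempotent_of_seq hsq hann hsign hfr
  let c : ℕ → A := fun k => ((1 / 2 : ℝ) ^ k) • 1
  have hc k : 0 ≤ c k := smul_nonneg (by positivity) zero_le_one
  have hcc k : c (k + 1) + c (k + 1) = c k := by
    simp only [c, ← add_smul]
    congr 1
    ring
  -- Idempotent-valued bisection: p k is the region where the next binary digit is 1. Every upper
  -- bound is at least s k + c (k + 1) there, and every x n is at most that off it. So s k stays
  -- below all upper bounds and s k + c k above all x n.
  let s : ℕ → A := fun k => k.rec 0 fun k s => s + c (k + 1) * P fun n => x n - s - c (k + 1)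
  let p : ℕ → A := fun k => P fun n => x n - s k - c (k + 1)
  have hs_succ k : s (k + 1) = s k + c (k + 1) * p k := rfl
  have hp k : p k * p k = p k := hP _
  have hp0 k : 0 ≤ p k := idempotent_nonneg hsq (hp k)
  have hp1 k : 0 ≤ 1 - p k := one_sub_idempotent_nonneg hsq (hp k)
  have hs_upper k : ∀ n, x n ≤ s k + c k := by
    induction k with
    | zero => intro n; simpa [s, c] using hx1 n
    | succ k ih =>
      intro n
      have h1 := hPneg (fun n => x n - s k - c (k + 1)) n
      have h2 := mul_nonneg (sub_nonneg.2 (ih n)) (hp0 k)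
      change (x n - s k - c (k + 1)) * (1 - p k) ≤ 0 at h1
      have h3 := sub_nonneg.2 h1
      rw [← sub_nonneg]
      refine le_trans (add_nonneg h2 h3) (le_of_eq ?_)
      rw [hs_succ]
      linear_combination -p k * hcc k
  have hs_lower z (hz : ∀ n, x n ≤ z) k : s k ≤ z := by
    induction k with
    | zero => exact (hx0 0).trans (hz 0)
    | succ k ih =>
      have h1 := hPpos (fun n => x n - s k - c (k + 1)) (z - s k - c (k + 1))
        fun n => sub_le_sub_right (sub_le_sub_right (hz n) _) _
      change 0 ≤ (z - s k - c (k + 1)) * p k at h1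
      have h2 := mul_nonneg (sub_nonneg.2 ih) (hp1 k)
      rw [← sub_nonneg]
      refine le_trans (add_nonneg h1 h2) (le_of_eq ?_)
      rw [hs_succ]
      ring
  obtain ⟨S, hS⟩ := hfr (fun k => c (k + 1) * p k) (fun k => (1 / 2 : ℝ) ^ (k + 1))
    (fun k => ⟨mul_nonneg (hc _) (hp0 k),
      mul_le_of_le_one_right (hc (k + 1)) (sub_nonneg.1 (hp1 k))⟩)
    ((summable_nat_add_iff 1).2 summable_geometric_two)
  have hsum n : ∑ k ∈ Finset.range n, c (k + 1) * p k = s n := by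
    induction n with
    | zero => rfl
    | succ n ih => rw [Finset.sum_range_succ, ih, hs_succ]
  simp only [hsum] at hS
  refine ⟨S, ?_, fun z hz => hS.2 ?_⟩
  · rintro _ ⟨n, rfl⟩
    rw [← sub_nonpos]
    refine nonpos_of_forall_le_half_pow hsign hsq hfr fun k => ?_
    -- The partial sums in FR start at s 1, hence the index k + 1 and the weaker error c k.
    have h1 : s (k + 1) ≤ S := hS.1 ⟨k, rfl⟩
    have h2 : c (k + 1) ≤ c k := by
      rw [← hcc k]
      exact le_add_of_nonneg_right (hc _)
    exact sub_le_iff_le_add'.2 ((hs_upper (k + 1) n).trans (add_le_add h1 h2))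
  · rintro _ ⟨n, rfl⟩
    exact hs_lower z (fun n => hz ⟨n, rfl⟩) (n + 1)

/-- Rescaling by the unit `√(b² + 1) + b` brings a bounded sequence into the unit interval. -/
theorem exists_isLUB_of_nonneg_of_le (hsq : ∀ x : A, 0 ≤ x * x)
    (hann : HasAnnihilatorIdempotents A) (hsign : HasSignIdempotents A) (hfr : HasFisherRiesz A)
    (hsqrt : ∀ x : A, 0 ≤ x → ∃ y, 0 ≤ y ∧ y * y = x)
    (x : ℕ → A) (b : A) (hx0 : ∀ n, 0 ≤ x n) (hxb : ∀ n, x n ≤ b) :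
    ∃ s, IsLUB (Set.range x) s := by
  obtain ⟨c, hc0, hc⟩ := hsqrt (b * b + 1) (add_nonneg (hsq b) zero_le_one)
  have hb : 0 ≤ b := (hx0 0).trans (hxb 0)
  -- The unit u = c + b has inverse v = c - b, and v = u v² ≥ 0, so multiplication by either
  -- preserves order.
  have huv : (c + b) * (c - b) = 1 := by linear_combination hc
  have hbu : b ≤ c + b := le_add_of_nonneg_left hc0
  generalize c + b = u, c - b = v at huv hbu
  have hu : 0 ≤ u := hb.trans hbu
  have hv : 0 ≤ v := by
    have := mul_nonneg hu (hsq v)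
    refine this.trans (le_of_eq ?_)
    linear_combination v * huv
  obtain ⟨s, hs⟩ := exists_isLUB_of_mem_unit_interval hsq hann hsign hfr (fun n => x n * v)
    (fun n => mul_nonneg (hx0 n) hv)
    (fun n => huv ▸ mul_le_mul_of_nonneg_right ((hxb n).trans hbu) hv)
  refine ⟨s * u, ?_, fun z hz => ?_⟩
  · rintro _ ⟨n, rfl⟩
    refine le_trans (le_of_eq ?_) (mul_le_mul_of_nonneg_right (hs.1 ⟨n, rfl⟩) hu)
    linear_combination -x n * huv
  · have h : s ≤ z * v := hs.2 <| by
      rintro _ ⟨n, rfl⟩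
      exact mul_le_mul_of_nonneg_right (hz ⟨n, rfl⟩) hv
    refine (mul_le_mul_of_nonneg_right h hu).trans (le_of_eq ?_)
    linear_combination z * huv

end OrderedRing

/-- An ordered additive group in which nonnegative order bounded sequences have suprema is
conditionally `σ`-complete as soon as it is a lattice. -/
theorem isConditionallySigmaComplete_of_nonneg {A : Type*} [AddCommGroup A] [Lattice A]
    [IsOrderedAddMonoid A]
    (h : ∀ (x : ℕ → A) (b : A), (∀ n, 0 ≤ x n) → (∀ n, x n ≤ b) → ∃ s, IsLUB (Set.range x) s) :
    IsConditionallySigmaComplete A := by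
  have hsup (S : Set A) (hS : S.Countable) (hne : S.Nonempty) (hb : BddAbove S) :
      ∃ s, IsLUB S s := by
    obtain ⟨x, rfl⟩ := hS.exists_eq_range hne
    obtain ⟨b, hb⟩ := hb
    -- Joining with x 0 leaves the upper bounds unchanged; subtracting x 0 then makes the sequence
    -- nonnegative.
    obtain ⟨s, hs⟩ := h (fun n => (x n ⊔ x 0) - x 0) (b - x 0)
      (fun n => sub_nonneg.2 le_sup_right)
      (fun n => sub_le_sub_right (sup_le (hb ⟨n, rfl⟩) (hb ⟨0, rfl⟩)) _)
    refine ⟨s + x 0, ?_, fun z hz => ?_⟩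
    · rintro _ ⟨n, rfl⟩
      exact le_sup_left.trans (sub_le_iff_le_add.1 (hs.1 ⟨n, rfl⟩))
    · refine le_sub_iff_add_le.1 (hs.2 ?_)
      rintro _ ⟨n, rfl⟩
      exact sub_le_sub_right (sup_le (hz ⟨n, rfl⟩) (hz ⟨0, rfl⟩)) _
  refine fun S hS hne => ⟨hsup S hS hne, fun hb => ?_⟩
  obtain ⟨s, hs⟩ := hsup (-S) (Set.image_neg_eq_neg (s := S) ▸ hS.image _) hne.neg hb.neg
  exact ⟨-s, by simpa using hs.neg⟩

/-! ### The cone and the lattice structure of the self-adjoint part -/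

section StarRing

variable {T : Type*} [CommRing T] [StarRing T]

theorem mul_mem_posCone {x y : T} (hx : x ∈ posCone T) (hy : y ∈ posCone T) :
    x * y ∈ posCone T := by
  obtain ⟨n, u, rfl⟩ := hx
  obtain ⟨m, v, rfl⟩ := hy
  refine ⟨n * m, fun i => u (finProdFinEquiv.symm i).1 * v (finProdFinEquiv.symm i).2, ?_⟩
  rw [← finProdFinEquiv.sum_comp, Fintype.sum_prod_type, Finset.sum_mul_sum]
  simp only [Equiv.symm_apply_apply, star_mul]
  exact Finset.sum_congr rfl fun i _ => Finset.sum_congr rfl fun j _ => by ring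

theorem star_mul_self_mem_posCone (x : T) : star x * x ∈ posCone T :=
  ⟨1, fun _ => x, by simp⟩

theorem IsSelfAdjoint.mul_self_mem_posCone {x : T} (hx : IsSelfAdjoint x) :
    x * x ∈ posCone T := by
  simpa [hx.star_eq] using star_mul_self_mem_posCone x

theorem isSelfAdjoint_of_mem_posCone {x : T} (hx : x ∈ posCone T) : IsSelfAdjoint x := by
  obtain ⟨n, u, rfl⟩ := hx
  simp [IsSelfAdjoint, star_sum, star_mul]

theorem IsStarProjection.mem_posCone {e : T} (he : IsStarProjection e) : e ∈ posCone T := by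
  simpa [he.isIdempotentElem.eq] using he.isSelfAdjoint.mul_self_mem_posCone

theorem IsAnnihilatingProjection.mul_eq_zero {x e : T} (h : IsAnnihilatingProjection x e) :
    x * e = 0 := by
  have : e ∈ rightAnnihilator x := h.2 ▸ ⟨1, by simp⟩
  exact this

theorem IsAnnihilatingProjection.mul_eq_self {x e t : T} (h : IsAnnihilatingProjection x e)
    (ht : x * t = 0) : e * t = t := by
  have : t ∈ rightAnnihilator x := ht
  rw [h.2] at this
  obtain ⟨s, rfl⟩ := this
  rw [← mul_assoc, h.1.isIdempotentElem.eq]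

/-- The two halves of a self-adjoint `x` cut out by `r(y - x) = eT`, where `y² = x²`. -/
theorem IsAnnihilatingProjection.mul_projection_add_self {x y e : T}
    (he : IsAnnihilatingProjection (y - x) e) (hyx : y ^ 2 = x ^ 2) : y * e = x * e ∧ y * e + y * e = x + y := by
  have h1 := he.mul_eq_zero
  have h2 := he.mul_eq_self (t := y + x) (by linear_combination hyx)
  exact ⟨by linear_combination h1, by linear_combination h1 + h2⟩

/-- Both ye and ye - x = y(1 - e) are products of cone elements. For an upper bound z, xe = ye gives
z - ye = (z - x)e + z(1 - e). -/
theorem isLUB_mul_projection (x : selfAdjoint T) {y e : T} (hy : y ∈ posCone T)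
    (hyx : y ^ 2 = (x : T) ^ 2) (he : IsAnnihilatingProjection (y - (x : T)) e)
    (p : selfAdjoint T) (hp : (p : T) = y * e) :
    letI := hermitianPreorder T
    IsLUB {x, 0} p := by
  let _ := hermitianPreorder T
  obtain ⟨h1, h2⟩ := he.mul_projection_add_self hyx
  have he' : 1 - e ∈ posCone T := he.1.one_sub.mem_posCone
  refine ⟨?_, fun z hz => ?_⟩
  · rintro a (ha | rfl)
    · rw [show a = x from ha]
      change (p : T) - x ∈ posCone T
      have := mul_mem_posCone hy he'
      rwa [show y * (1 - e) = (p : T) - x by rw [hp]; linear_combination -h2] at this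
    · change (p : T) - ((0 : selfAdjoint T) : T) ∈ posCone T
      rw [hp, ZeroMemClass.coe_zero, sub_zero]
      exact mul_mem_posCone hy he.1.mem_posCone
  · have hzx : (z : T) - x ∈ posCone T := hz (Or.inl rfl)
    have hz0 : (z : T) - ((0 : selfAdjoint T) : T) ∈ posCone T := hz (Or.inr rfl)
    rw [ZeroMemClass.coe_zero, sub_zero] at hz0
    change (z : T) - p ∈ posCone T
    have := add_mem_posCone (mul_mem_posCone hzx he.1.mem_posCone) (mul_mem_posCone hz0 he')
    rwa [show ((z : T) - x) * e + z * (1 - e) = z - p by rw [hp]; linear_combination h1] at this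

/-- With r(x⋆) = eT, membership of x gives ex = x, while the adjoint of x⋆e = 0 gives ex = 0. -/
theorem IsRickartStarRing.eq_zero_of_star_mul_self (hT : IsRickartStarRing T) {x : T}
    (hx : star x * x = 0) : x = 0 := by
  obtain ⟨e, he⟩ := hT (star x)
  have h := congrArg star he.mul_eq_zero
  rw [star_mul, star_star, star_zero, he.1.isSelfAdjoint.star_eq, he.mul_eq_self hx] at h
  exact h

variable [Algebra ℂ T] [StarModule ℂ T]

theorem smul_mem_posCone {r : ℝ} (hr : 0 ≤ r) {x : T} (hx : x ∈ posCone T) :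
    r • x ∈ posCone T := by
  obtain ⟨n, u, rfl⟩ := hx
  refine ⟨n, fun i => Real.sqrt r • u i, ?_⟩
  simp only [star_smul, star_trivial, smul_mul_smul_comm, Real.mul_self_sqrt hr, Finset.smul_sum]

namespace IsROStarAlgebra

theorem exists_sqrt (hT : IsROStarAlgebra T) {x : T} (hx : x ∈ posCone T) :
    ∃ y ∈ posCone T, y ^ 2 = x := by
  obtain ⟨y, hy, h⟩ := hT.psr x hx
  exact ⟨y, hy.1, h⟩

/-- If x = a² and -x = b² with a, b self-adjoint, then z = a + ib satisfies z⋆z = a² + b² = 0. So z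
= 0, and adding its adjoint gives 2a = 0. -/
theorem eq_zero_of_mem_posCone_of_neg_mem (hT : IsROStarAlgebra T) {x : T} (hx : x ∈ posCone T)
    (hx' : -x ∈ posCone T) : x = 0 := by
  obtain ⟨a, ha, rfl⟩ := hT.exists_sqrt hx
  obtain ⟨b, hb, hab⟩ := hT.exists_sqrt hx'
  have ha' := (isSelfAdjoint_of_mem_posCone ha).star_eq
  have hb' := (isSelfAdjoint_of_mem_posCone hb).star_eq
  have hI : (algebraMap ℂ T Complex.I) * algebraMap ℂ T Complex.I = -1 := by
    rw [← map_mul, Complex.I_mul_I, map_neg, map_one]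
  have hz : a + Complex.I • b = 0 := by
    refine hT.rickart.eq_zero_of_star_mul_self ?_
    rw [star_add, star_smul, ha', hb']
    simp only [Complex.star_def, Complex.conj_I, Algebra.smul_def, map_neg]
    linear_combination hab - b ^ 2 * hI
  have hz' := congrArg star hz
  rw [star_add, star_smul, ha', hb', star_zero] at hz'
  simp only [Complex.star_def, Complex.conj_I, neg_smul] at hz'
  have h2 : a + a = 0 := by linear_combination hz + hz'
  rw [← two_smul ℂ a, smul_eq_zero_iff_right two_ne_zero] at h2
  simp [h2]

/-- The order on the self-adjoint part given by the cone. -/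
@[reducible] def hermitianPartialOrder (hT : IsROStarAlgebra T) :
    PartialOrder (selfAdjoint T) where
  toPreorder := hermitianPreorder T
  le_antisymm x y hxy hyx := by
    have hyx' : -((y : T) - x) ∈ posCone T := by rw [neg_sub]; exact hyx
    exact Subtype.ext (sub_eq_zero.1 (hT.eq_zero_of_mem_posCone_of_neg_mem hxy hyx')).symm

theorem exists_isLUB_pair_zero (hT : IsROStarAlgebra T) (x : selfAdjoint T) :
    letI := hermitianPreorder T
    ∃ p : selfAdjoint T, IsLUB {x, 0} p := by
  obtain ⟨y, hy, hyx⟩ := hT.exists_sqrt (x := (x : T) ^ 2)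
    (by rw [sq]; exact x.2.mul_self_mem_posCone)
  obtain ⟨e, he⟩ := hT.rickart (y - x)
  exact ⟨⟨y * e, isSelfAdjoint_of_mem_posCone (mul_mem_posCone hy he.1.mem_posCone)⟩,
    isLUB_mul_projection x hy hyx he _ rfl⟩

/-- The lattice structure on the self-adjoint part. -/
@[reducible] noncomputable def hermitianLattice (hT : IsROStarAlgebra T) :
    Lattice (selfAdjoint T) :=
  letI := hT.hermitianPartialOrder
  haveI : IsOrderedAddMonoid (selfAdjoint T) :=
    { add_le_add_left := fun a b hab c => by
        change ((b + c : selfAdjoint T) : T) - ((a + c : selfAdjoint T) : T) ∈ posCone T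
        have hab' : (b : T) - a ∈ posCone T := hab
        simpa using hab' }
  have hlub (x y : selfAdjoint T) : ∃ s, IsLUB {x, y} s := by
    obtain ⟨p, hp⟩ := hT.exists_isLUB_pair_zero (x - y)
    refine ⟨p + y, ?_, fun z hz => ?_⟩
    · rintro _ (rfl | rfl)
      · exact sub_le_iff_le_add.1 (hp.1 (Or.inl rfl))
      · exact le_add_of_nonneg_left (hp.1 (Or.inr rfl))
    · refine le_sub_iff_add_le.1 (hp.2 ?_)
      rintro _ (rfl | rfl)
      · exact sub_le_sub_right (hz (Or.inl rfl)) _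
      · exact sub_nonneg.2 (hz (Or.inr rfl))
  { hT.hermitianPartialOrder with
    sup := fun x y => (hlub x y).choose
    le_sup_left := fun x y => (hlub x y).choose_spec.1 (Or.inl rfl)
    le_sup_right := fun x y => (hlub x y).choose_spec.1 (Or.inr rfl)
    sup_le := fun x y z hx hy => (hlub x y).choose_spec.2 (by rintro _ (rfl | rfl) <;> assumption)
    inf := fun x y => -(hlub (-x) (-y)).choose
    inf_le_left := fun x y => neg_le.1 ((hlub (-x) (-y)).choose_spec.1 (Or.inl rfl))
    inf_le_right := fun x y => neg_le.1 ((hlub (-x) (-y)).choose_spec.1 (Or.inr rfl))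
    le_inf := fun x y z hx hy => le_neg.1 <| (hlub (-y) (-z)).choose_spec.2 (by
      rintro _ (rfl | rfl)
      · exact neg_le_neg hx
      · exact neg_le_neg hy) }

end IsROStarAlgebra

end StarRing

/-! ### Assembly of the theorem -/

theorem theorem2 {T : Type*} [CommRing T] [StarRing T] [Algebra ℂ T] [StarModule ℂ T]
    (hT : IsROStarAlgebra T) :
    ∃ _ : Lattice (selfAdjoint T),
      -- the lattice order is the one defined by the cone `K`
      (∀ x y : selfAdjoint T, x ≤ y ↔ (y : T) - (x : T) ∈ posCone T) ∧
      -- `T_h` is a (real) vector lattice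
      IsOrderedAddMonoid (selfAdjoint T) ∧ IsOrderedModule ℝ (selfAdjoint T) ∧
      -- `x ∨ 0 = y e` with `y ∈ K`, `y² = x²` and `r(y - x) = e T`; such `y` and `e` exist
      (∀ x : selfAdjoint T,
        (∃ y ∈ posCone T, y ^ 2 = (x : T) ^ 2) ∧
        ∀ y ∈ posCone T, y ^ 2 = (x : T) ^ 2 →
          (∃ e : T, IsAnnihilatingProjection (y - (x : T)) e) ∧
          ∀ e : T, IsAnnihilatingProjection (y - (x : T)) e →
            ((x ⊔ 0 : selfAdjoint T) : T) = y * e) ∧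
      IsConditionallySigmaComplete (selfAdjoint T) := by
  let _ := hT.hermitianLattice
  have hle (x y : selfAdjoint T) : x ≤ y ↔ (y : T) - (x : T) ∈ posCone T := Iff.rfl
  have hnn (x : selfAdjoint T) : 0 ≤ x ↔ (x : T) ∈ posCone T := by simp [hle]
  have hsq (x : selfAdjoint T) : 0 ≤ x * x := (hnn _).2 x.2.mul_self_mem_posCone
  have : IsOrderedAddMonoid (selfAdjoint T) :=
    { add_le_add_left := fun a b hab c => by
        rw [hle] at hab ⊢
        simpa using hab }
  have : ZeroLEOneClass (selfAdjoint T) := ⟨by simpa using hsq 1⟩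
  have : IsOrderedRing (selfAdjoint T) := IsOrderedRing.of_mul_nonneg fun a b ha hb => by
    rw [hnn] at ha hb ⊢
    exact mul_mem_posCone ha hb
  have : IsOrderedModule ℝ (selfAdjoint T) := IsOrderedModule.of_smul_nonneg fun r hr a ha => by
    rw [hnn] at ha ⊢
    exact smul_mem_posCone hr ha
  have : IsScalarTower ℝ (selfAdjoint T) (selfAdjoint T) :=
    ⟨fun r a b => Subtype.ext (smul_mul_assoc r (a : T) (b : T))⟩
  have hsquare (x : selfAdjoint T) : ∃ y ∈ posCone T, y ^ 2 = (x : T) ^ 2 :=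
    hT.exists_sqrt (by rw [sq]; exact x.2.mul_self_mem_posCone)
  refine ⟨inferInstance, hle, inferInstance, inferInstance, fun x => ⟨hsquare x, ?_⟩, ?_⟩
  · refine fun y hy hyx => ⟨hT.rickart _, fun e he => ?_⟩
    have hp : IsSelfAdjoint (y * e) :=
      isSelfAdjoint_of_mem_posCone (mul_mem_posCone hy he.1.mem_posCone)
    exact congrArg Subtype.val
      (isLUB_pair.unique (isLUB_mul_projection x hy hyx he ⟨y * e, hp⟩ rfl))
  · have hann : HasAnnihilatorIdempotents (selfAdjoint T) := fun x => by
      obtain ⟨e, he⟩ := hT.rickart x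
      exact ⟨⟨e, he.1.isSelfAdjoint⟩, Subtype.ext he.1.isIdempotentElem.eq,
        Subtype.ext he.mul_eq_zero,
        fun t ht => Subtype.ext (he.mul_eq_self (congrArg Subtype.val ht))⟩
    -- With y² = w², the projection of r(y - w) works: we = ye and -w(1 - e) = y(1 - e) both lie in
    -- the cone.
    have hsign : HasSignIdempotents (selfAdjoint T) := fun w => by
      obtain ⟨y, hy, hyw⟩ := hsquare w
      obtain ⟨e, he⟩ := hT.rickart (y - w)
      obtain ⟨h1, h2⟩ := he.mul_projection_add_self hyw
      refine ⟨⟨e, he.1.isSelfAdjoint⟩, Subtype.ext he.1.isIdempotentElem.eq, ?_, ?_⟩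
      · rw [hnn]
        change (w : T) * e ∈ posCone T
        rw [← h1]
        exact mul_mem_posCone hy he.1.mem_posCone
      · rw [hle]
        change (0 : T) - (w : T) * (1 - e) ∈ posCone T
        rw [show (0 : T) - (w : T) * (1 - e) = y * (1 - e) by linear_combination h2 - h1]
        exact mul_mem_posCone hy he.1.one_sub.mem_posCone
    have hsqrt (x : selfAdjoint T) (hx : 0 ≤ x) : ∃ y, 0 ≤ y ∧ y * y = x := by
      obtain ⟨y, hy, hyx⟩ := hT.exists_sqrt ((hnn x).1 hx)
      exact ⟨⟨y, isSelfAdjoint_of_mem_posCone hy⟩, (hnn _).2 hy,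
        Subtype.ext (by rw [← hyx, sq]; rfl)⟩
    exact isConditionallySigmaComplete_of_nonneg
      (exists_isLUB_of_nonneg_of_le hsq hann hsign hT.fr hsqrt)
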